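/- **Setting.** Let $A=\begin{bmatrix}0&I_3\\0&0\end{bmatrix}$, $B=\begin{bmatrix}0\\I_3\end{bmatrix}$. For $N$ rigid bodies with outer-loop (position and velocity) errors $e_i(t)\in\mathbb R^6$ and disturbances $w_i(t)\in\mathbb R^6$, consider the network $$\dot e_i=(A+B\bar L_{ii})e_i+\eta_i,\qquad \eta_i=\sum_{j=1}^N K_{ij}e_j+w_i,\qquad z_i=e_i,\qquad i=1,\dots,N,$$ with given local gains $\bar L_{ii}\in\mathbb R^{3\times 6}$ and with $M_{\eta e}=[K_{ij}]$, $K_{ij}=\begin{bmatrix}0&0\\ k^x_{ij}&k^v_{ij}\end{bmatrix}\in\mathbb R^{6\times6}$. Write $|\cdot|$ for the Euclidean norm, $\|\cdot\|$ for the spectral norm, $\|\cdot\|_1$ for the matrix 1-norm, $\mathcal S(X)=X+X^\top$, and $\|w_i\|_\infty=\sup_{t\ge0}|w_i(t)|$. Let $\nu_i,\rho_i,\epsilon_i\in\mathbb R$ and symmetric $R_i>0$ be given such that, for every $i$: * the subsystem $\dot e_i=(A+B\bar L_{ii})e_i+\eta_i$ with input $\eta_i$ and output $e_i$ is IF-OFP($\nu_i,\rho_i$),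 i.e. there is a $C^1$ storage function $V_i$ with $V_i(0)=0$, $V_i(x)>0$ for $x\ne0$, and $\nabla V_i(x)\cdot\big((A+B\bar L_{ii})x+\eta\big)\le-\nu_i|\eta|^2+\eta^\top x-\rho_i|x|^2$ for all $x,\eta\in\mathbb R^6$; * $\mathcal S\big((A+B\bar L_{ii})^\top R_i\big)\le-\rho_iI$; * $0<\delta_i<1$, where $\mu_i=\dfrac{\rho_i+\epsilon_i-1}{\lambda_{\max}(R_i)}$ and $\delta_i=\sqrt{\mu_i\lambda_{\min}(R_i)}$. **Centralized problem.** For given $\bar\gamma$, $c_0>0$ and weights $c_{ij}$, with $\tilde\gamma=\gamma^2$, $\gamma>0$, minimise $$\sum_{i,j}c_{ij}\|Q_{ij}\|_1+c_0\tilde\gamma$$ over $Q=[Q_{ij}]$ (each $Q_{ij}$ of the form $\begin{bmatrix}0&0\\ *&*\end{bmatrix}$), $\gamma$ and $p_i$, subject to $p_i>0$, $0<\tilde\gamma<\bar\gamma$, $$\begin{bmatrix}\mathbf X_p^{11}&0&Q&\mathbf X_p^{11}\\0&I&I&0\\Q^\top&I&-Q^\top\mathbf X^{12}-\mathbf X^{21}Q-\mathbf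 X_p^{22}&-\mathbf X^{21}\mathbf X_p^{11}\\\mathbf X_p^{11}&0&-\mathbf X_p^{11}\mathbf X^{12}&\tilde\gamma I\end{bmatrix}>0,$$ $$\mathcal S(R_iQ_{ii})\le p_i\nu_i\epsilon_iI,\qquad \sum_{j\ne i}\|R_iQ_{ij}\|<-p_i\nu_i\delta_i\qquad(i=1,\dots,N),$$ where $\mathbf X_p^{11}=\mathrm{diag}(-p_i\nu_iI)$, $\mathbf X_p^{22}=\mathrm{diag}(-p_i\rho_iI)$, $\mathbf X^{12}=\mathrm{diag}(-\tfrac1{2\nu_i}I)$, $\mathbf X^{21}=(\mathbf X^{12})^\top$. **Theorem.** Take any feasible point of this problem (in particular a minimiser, if there is one) and close the network with $M_{\eta e}=(\mathbf X_p^{11})^{-1}Q$. Then: 1. *(Finite-gain $L_2$-stability.)* The network is finite-gain $L_2$-stable from $w$ to $z$ with gain $\gamma$, and $\gamma^2<\bar\gamma$. That is, it has a $C^1$ storage function, zero at $0$ and positive elsewhere, whose derivative along the network is at most $\gamma^2|w|^2-|z|^2$; and along every solution $\|z\|_{L_2}\le\gamma\|w\|_{L_2}+b(e(0))$, on every interval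 $[0,T]$ and on $[0,\infty)$, where $b\geq 0$ depends only on the initial state and $b(0)=0$. 2. *(Scalable mesh stability.)* There are $\beta\in\mathcal{KL}$, $\sigma\in\mathcal K_\infty$ and $c_x,c_w>0$ such that, whenever $\sup_i|e_i(0)|<c_x$ and $w$ is measurable and bounded with $\sup_i\|w_i\|_\infty<c_w$, a solution exists on $[0,\infty)$ and every solution satisfies $$\sup_i|e_i(t)|\le\beta\Big(\sup_i|e_i(0)|,t\Big)+\sigma\Big(\sup_i\|w_i\|_\infty\Big)\qquad\text{for all }t\ge0 .$$ 3. *(Uniformity in the size of the network.)* Given any family of networks of arbitrary sizes $N$, each designed in this way, suppose that there are $\kappa>0$, $M$ and $\theta<1$ such that $\kappa\le\lambda_{\min}(R_i)$, $\lambda_{\max}(R_i)\le M$, $\kappa\le\mu_i$ and $\sum_{j\ne i}\|R_iQ_{ij}\|\le-\theta p_i\nu_i\delta_i$ for all agents of all networks of the family. Then the same $\beta,\sigma,c_x,c_w$ in 2 can be used for all the networks of the family, so they do not depend on $N$. -/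

import Mathlib

open MeasureTheory Set Filter Topology
open scoped ENNReal

noncomputable section

/-! ## Comparison functions -/

/-- Class `𝒦`: continuous and strictly increasing on `[0, ∞)`, zero at zero. -/
def IsClassK (α : ℝ → ℝ) : Prop :=
  ContinuousOn α (Ici 0) ∧ StrictMonoOn α (Ici 0) ∧ α 0 = 0

/-- Class `𝒦_∞`: class `𝒦` and unbounded. -/
def IsClassKInf (α : ℝ → ℝ) : Prop :=
  IsClassK α ∧ Tendsto α atTop atTop

/-- Class `𝒦ℒ`: class `𝒦` in the first argument, decreasing to zero in the second one. -/
def IsClassKL (β : ℝ → ℝ → ℝ) : Prop :=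
  (∀ t, 0 ≤ t → IsClassK fun r => β r t) ∧
  (∀ r, 0 ≤ r → AntitoneOn (β r) (Ici 0) ∧ Tendsto (β r) atTop (𝓝 0))

/-! ## Dissipativity about an equilibrium at the origin -/

/-- The system `ẋ = f(x, u)`, `y = h(x, u)`, with equilibrium `x = 0`, `u = 0`, `y = 0`, is
dissipative with supply rate `s`: there is a continuously differentiable storage function `V`,
positive away from the equilibrium and zero at it, with `∇V(x) f(x, u) ≤ s(u, y)`. -/
def IsDissipative {E U Y : Type*} [NormedAddCommGroup E] [NormedSpace ℝ E]
    [NormedAddCommGroup U] [NormedAddCommGroup Y]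
    (f : E → U → E) (h : E → U → Y) (s : U → Y → ℝ) : Prop :=
  f 0 0 = 0 ∧ h 0 0 = 0 ∧
  ∃ V : E → ℝ, ContDiff ℝ 1 V ∧ V 0 = 0 ∧ (∀ x, x ≠ 0 → 0 < V x) ∧
    ∀ x u, fderiv ℝ V x (f x u) ≤ s u (h x u)

/-- Supply rate of IF-OFP(`ν`, `ρ`) (input feedforward index `ν`, output feedback index `ρ`). -/
def supplyIFOFP {E : Type*} [NormedAddCommGroup E] [InnerProductSpace ℝ E] (ν ρ : ℝ)
    (u y : E) : ℝ :=
  -ν * ‖u‖ ^ 2 + inner ℝ u y - ρ * ‖y‖ ^ 2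

/-- Supply rate of finite-gain `L₂`-stability with gain `γ`. -/
def supplyL2G {U Y : Type*} [NormedAddCommGroup U] [NormedAddCommGroup Y] (γ : ℝ)
    (u : U) (y : Y) : ℝ :=
  γ ^ 2 * ‖u‖ ^ 2 - ‖y‖ ^ 2

/-! ## Matrices -/

/-- Coordinates of the outer-loop error of one rigid body: position error, velocity error. -/
abbrev BodyIdx := Fin 3 ⊕ Fin 3

/-- `ℝ⁶` with the Euclidean norm. -/
abbrev BodyState := EuclideanSpace ℝ BodyIdx

/-- The stacked vectors `[e_i]`, `[w_i]`, with the Euclidean norm `‖e‖² = ∑ i, ‖e_i‖²`. -/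
abbrev NetState (N : ℕ) := PiLp 2 fun _ : Fin N => BodyState

abbrev BodyMat := Matrix BodyIdx BodyIdx ℝ

/-- The linear map of `ℝ⁶` given by a matrix. -/
abbrev BodyMat.op (M : BodyMat) : BodyState →L[ℝ] BodyState :=
  Matrix.toEuclideanCLM (𝕜 := ℝ) M

/-- Spectral norm. -/
def specNorm (M : BodyMat) : ℝ := ‖BodyMat.op M‖

/-- Matrix 1-norm (largest absolute column sum). -/
def oneNorm (M : BodyMat) : ℝ := ⨆ b, ∑ a, |M a b|

/-- `𝒮(M) = M + Mᵀ`. -/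
def symSum (M : BodyMat) : BodyMat := M + M.transpose

/-- Smallest eigenvalue (used for symmetric matrices). -/
def lambdaMin (M : BodyMat) : ℝ := sInf (spectrum ℝ M)

/-- Largest eigenvalue (used for symmetric matrices). -/
def lambdaMax (M : BodyMat) : ℝ := sSup (spectrum ℝ M)

/-- `A = [0 I; 0 0]`. -/
def outerA : BodyMat := Matrix.fromBlocks 0 1 0 0

/-- `B = [0; I]`. -/
def outerB : Matrix BodyIdx (Fin 3) ℝ := Matrix.fromRows 0 1

/-! ## The error network -/

/-- The gains of a network of `N` rigid bodies: the local controllers `L̄_ii` and the blocks `K_ij`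
of the interconnection matrix `M_{ηe}`. -/
structure ErrorNetwork (N : ℕ) where
  Lbar : Fin N → Matrix (Fin 3) BodyIdx ℝ
  K : Fin N → Fin N → BodyMat

/-- Right-hand side `ė_i = (A + B L̄_ii) e_i + η_i` of one subsystem with input `η_i`. -/
def subsystemField (L : Matrix (Fin 3) BodyIdx ℝ) (x η : BodyState) : BodyState :=
  BodyMat.op (outerA + outerB * L) x + η

namespace ErrorNetwork

variable {N : ℕ}

/-- The subsystem inputs `η_i = ∑ j, K_ij e_j + w_i` (so `M_{ηw} = I`). -/
def input (net : ErrorNetwork N) (e w : NetState N) (i : Fin N) : BodyState :=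
  ∑ j, BodyMat.op (net.K i j) (e j) + w i

/-- Right-hand side of the closed-loop network. -/
def field (net : ErrorNetwork N) (e w : NetState N) : NetState N :=
  WithLp.toLp 2 fun i => subsystemField (net.Lbar i) (e i) (net.input e w i)

/-- The performance output `z = M_{ze} e + M_{zw} w` with `M_{ze} = I`, `M_{zw} = 0`. -/
def output (_net : ErrorNetwork N) (e _w : NetState N) : NetState N := e

/-- `e` is a (Carathéodory) solution of the closed-loop network on `[0, ∞)` for the
disturbance `w`. -/
def IsSolution (net : ErrorNetwork N) (w e : ℝ → NetState N) : Prop :=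
  ContinuousOn e (Ici 0) ∧
  ∀ t, 0 ≤ t → IntervalIntegrable (fun s => net.field (e s) (w s)) volume 0 t ∧
    e t = e 0 + ∫ s in (0 : ℝ)..t, net.field (e s) (w s)

/-- Finite-gain `L₂`-stability from `w` to `z` with gain `γ`: the network is dissipative for the
supply rate `γ²‖w‖² - ‖z‖²`, and along every solution the `L₂` norms of `z` and `w`, on every
`[0, T]` and on `[0, ∞)`, satisfy `‖z‖ ≤ γ ‖w‖ + b(e(0))`, where the bias `b` vanishes at rest. -/
def IsL2Stable (net : ErrorNetwork N) (γ : ℝ) : Prop :=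
  IsDissipative net.field net.output (supplyL2G γ) ∧
  ∃ b : NetState N → NNReal, b 0 = 0 ∧
    ∀ w e : ℝ → NetState N, net.IsSolution w e →
      ∀ I : Set ℝ, ((∃ T : ℝ, 0 ≤ T ∧ I = Icc 0 T) ∨ I = Ici 0) →
        eLpNorm (fun t => net.output (e t) (w t)) 2 (volume.restrict I) ≤
          ENNReal.ofReal γ * eLpNorm w 2 (volume.restrict I) + (b (e 0) : ℝ≥0∞)

end ErrorNetwork

/-- Scalable mesh stability, about the equilibrium `e = 0`, of a family of networks of arbitrary
sizes `N l`: one `β ∈ 𝒦ℒ`, one `σ ∈ 𝒦_∞` and one pair `c_x, c_w > 0` serve all members. For small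
initial errors and small bounded disturbances a solution exists on `[0, ∞)`, and every solution
satisfies the estimate. -/
def IsScalableMeshStable {Λ : Type*} (N : Λ → ℕ) (net : ∀ l, ErrorNetwork (N l)) : Prop :=
  ∃ (β : ℝ → ℝ → ℝ) (σ : ℝ → ℝ) (cx cw : ℝ),
    IsClassKL β ∧ IsClassKInf σ ∧ 0 < cx ∧ 0 < cw ∧
    ∀ (l : Λ) (e₀ : NetState (N l)) (w : ℝ → NetState (N l)),
      AEStronglyMeasurable w (volume.restrict (Ici 0)) →
      (∀ i, BddAbove (range fun t : Ici (0 : ℝ) => ‖w t i‖)) →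
      (⨆ i, ‖e₀ i‖) < cx →
      (⨆ i, ⨆ t : Ici (0 : ℝ), ‖w t i‖) < cw →
      (∃ e, (net l).IsSolution w e ∧ e 0 = e₀) ∧
      ∀ e, (net l).IsSolution w e → e 0 = e₀ → ∀ t, 0 ≤ t →
        (⨆ i, ‖e t i‖) ≤ β (⨆ i, ‖e₀ i‖) t + σ (⨆ i, ⨆ t : Ici (0 : ℝ), ‖w t i‖)

/-! ## The centralized co-design problem -/

/-- The given data: local controllers `L̄_ii`, passivity indices `ν_i`, `ρ_i`, matrices `R_i`,
scalars `ε_i`, cost weights `c_ij`, `c_0`, and the bound `γ̄` on the squared gain. -/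
structure DesignData (N : ℕ) where
  Lbar : Fin N → Matrix (Fin 3) BodyIdx ℝ
  ν : Fin N → ℝ
  ρ : Fin N → ℝ
  R : Fin N → BodyMat
  ε : Fin N → ℝ
  c : Fin N → Fin N → ℝ
  c₀ : ℝ
  γbar : ℝ

/-- The decision variables `Q = [Q_ij]`, `γ` and `p_i`. -/
structure DesignVars (N : ℕ) where
  Q : Fin N → Fin N → BodyMat
  γ : ℝ
  p : Fin N → ℝ

/-- A minimisation problem. -/
structure MinProblem (α : Type*) where
  cost : α → ℝ
  feasible : Set α

/-- The block matrix `[Q_ij]`. -/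
def stackBlocks {N : ℕ} (Q : Fin N → Fin N → BodyMat) :
    Matrix (Fin N × BodyIdx) (Fin N × BodyIdx) ℝ :=
  Matrix.of fun ia jb => Q ia.1 jb.1 ia.2 jb.2

/-- The block-diagonal matrix `diag([d_i I])`. -/
def scalarBlocks {N : ℕ} (d : Fin N → ℝ) : Matrix (Fin N × BodyIdx) (Fin N × BodyIdx) ℝ :=
  Matrix.diagonal fun ia => d ia.1

namespace DesignData

variable {N : ℕ}

/-- `μ_i = (ρ_i + ε_i - 1) / λ_max(R_i)`. -/
def μ (S : DesignData N) (i : Fin N) : ℝ := (S.ρ i + S.ε i - 1) / lambdaMax (S.R i)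

/-- `δ_i = √(μ_i λ_min(R_i))`. -/
def δ (S : DesignData N) (i : Fin N) : ℝ := Real.sqrt (S.μ i * lambdaMin (S.R i))

/-- What is known about the local loops: every subsystem `ė_i = (A + B L̄_ii) e_i + η_i`, with
output `e_i`, is IF-OFP(`ν_i`, `ρ_i`); `R_i > 0` with `𝒮((A + B L̄_ii)ᵀ R_i) ≤ -ρ_i I`; and
`0 < δ_i < 1`. -/
structure LocalLoops (S : DesignData N) : Prop where
  ifofp : ∀ i, IsDissipative (subsystemField (S.Lbar i)) (fun x _ => x)
    (supplyIFOFP (S.ν i) (S.ρ i))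
  R_posDef : ∀ i, (S.R i).PosDef
  lyapunov : ∀ i, (-(S.ρ i) • (1 : BodyMat) -
    symSum ((outerA + outerB * S.Lbar i).transpose * S.R i)).PosSemidef
  δ_pos : ∀ i, 0 < S.δ i
  δ_lt_one : ∀ i, S.δ i < 1

/-- `𝐗_p¹¹ = diag([-p_i ν_i I])`. -/
def Xp11 (S : DesignData N) (D : DesignVars N) :
    Matrix (Fin N × BodyIdx) (Fin N × BodyIdx) ℝ :=
  scalarBlocks fun i => -(D.p i * S.ν i)

/-- `𝐗_p²² = diag([-p_i ρ_i I])`. -/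
def Xp22 (S : DesignData N) (D : DesignVars N) :
    Matrix (Fin N × BodyIdx) (Fin N × BodyIdx) ℝ :=
  scalarBlocks fun i => -(D.p i * S.ρ i)

/-- `𝐗¹² = diag([-(1 / (2 ν_i)) I])`. -/
def X12 (S : DesignData N) :
    Matrix (Fin N × BodyIdx) (Fin N × BodyIdx) ℝ :=
  scalarBlocks fun i => -(1 / (2 * S.ν i))

/-- `𝐗²¹ = (𝐗¹²)ᵀ`. -/
def X21 (S : DesignData N) :
    Matrix (Fin N × BodyIdx) (Fin N × BodyIdx) ℝ :=
  S.X12.transpose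

/-- The `4 × 4`-block matrix of the linear matrix inequality. -/
def lmiMatrix (S : DesignData N) (D : DesignVars N) :
    Matrix (((Fin N × BodyIdx) ⊕ (Fin N × BodyIdx)) ⊕ ((Fin N × BodyIdx) ⊕ (Fin N × BodyIdx)))
      (((Fin N × BodyIdx) ⊕ (Fin N × BodyIdx)) ⊕ ((Fin N × BodyIdx) ⊕ (Fin N × BodyIdx))) ℝ :=
  let Q := stackBlocks D.Q
  Matrix.fromBlocks
    (Matrix.fromBlocks (S.Xp11 D) 0
      0 1)
    (Matrix.fromBlocks Q (S.Xp11 D)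
      1 0)
    (Matrix.fromBlocks Q.transpose 1
      (S.Xp11 D) 0)
    (Matrix.fromBlocks (-(Q.transpose * S.X12) - S.X21 * Q - S.Xp22 D) (-(S.X21 * S.Xp11 D))
      (-(S.Xp11 D * S.X12)) (D.γ ^ 2 • 1))

/-- `∑_{j ≠ i} ‖R_i Q_ij‖`. -/
def couplingSum (S : DesignData N) (D : DesignVars N) (i : Fin N) : ℝ :=
  ∑ j ∈ Finset.univ.erase i, specNorm (S.R i * D.Q i j)

/-- The constraints of the centralized problem. -/
structure Constraints (S : DesignData N) (D : DesignVars N) : Prop where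
  p_pos : ∀ i, 0 < D.p i
  γ_pos : 0 < D.γ
  γ_lt : D.γ ^ 2 < S.γbar
  /-- `Q_ij = [0 0; * *]`, the structure of the blocks `K_ij`. -/
  structured : ∀ i j (a : Fin 3) (b : BodyIdx), D.Q i j (Sum.inl a) b = 0
  lmi : (S.lmiMatrix D).PosDef
  diag_block : ∀ i, ((D.p i * S.ν i * S.ε i) • (1 : BodyMat) -
    symSum (S.R i * D.Q i i)).PosSemidef
  weak_coupling : ∀ i, S.couplingSum D i < -(D.p i * S.ν i * S.δ i)

/-- Minimise `∑ c_ij ‖Q_ij‖₁ + c_0 γ²` subject to the constraints. -/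
def centralizedProblem (S : DesignData N) : MinProblem (DesignVars N) where
  cost D := ∑ i, ∑ j, S.c i j * oneNorm (D.Q i j) + S.c₀ * D.γ ^ 2
  feasible := {D | S.Constraints D}

/-- The network closed with `M_{ηe} = (𝐗_p¹¹)⁻¹ Q`. -/
def closedLoop (S : DesignData N) (D : DesignVars N) : ErrorNetwork N where
  Lbar := S.Lbar
  K i j := Matrix.of fun a b => ((S.Xp11 D)⁻¹ * stackBlocks D.Q) (i, a) (j, b)

end DesignData

/-- The data of a family of designs are bounded uniformly over all agents of all its members, and
so is the margin in the weak-coupling bound. -/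
def UniformData {Λ : Type*} {N : Λ → ℕ} (S : ∀ l, DesignData (N l))
    (D : ∀ l, DesignVars (N l)) : Prop :=
  ∃ κ M θ : ℝ, 0 < κ ∧ θ < 1 ∧ ∀ l i,
    κ ≤ lambdaMin ((S l).R i) ∧ lambdaMax ((S l).R i) ≤ M ∧ κ ≤ (S l).μ i ∧
    (S l).couplingSum (D l) i ≤ θ * -((D l).p i * (S l).ν i * (S l).δ i)

end

/-! ## Calculus along absolutely continuous curves -/

/-! The linear matrix inequality forces `-p_i ν_i > 0`, so closing the loop divides the block rows
of `Q` by positive scalars, and every constraint on `Q` passes to `K`.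

Gain: the storage function of the network is `∑ p_i V_i`. Its derivative is at most the weighted sum
of the IF-OFP supply rates, and the matrix inequality, tested on the vector `(-η, -e, e, w)`, bounds
that sum by `γ²|w|² - |e|²` (`sum_supplyIFOFP_le`). Integrating along a Carathéodory solution and
taking square roots gives the `L₂` estimate.

Mesh stability: use one energy `q_i = e_iᵀ R_i e_i` per agent and never sum over agents, so that no
constant depends on `N`. If all `|e_j|² ≤ B`, the Lyapunov, diagonal and coupling constraints give,
with `τ > 0` free, `q_i' ≤ -(μ_i - τ) q_i + θ² μ_i λ_min(R_i) B + λ_max(R_i) ω² / τ`, where `ω`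
bounds the disturbances and `θ < 1` is the coupling margin (`two_mul_inner_op_field_le`). Compare
`q_i / λ_min(R_i)` with `B(t) = a exp(-αt) + d`. While all ratios are at most `B`, all `|e_j|²` are
too, and a ratio close to `B` decreases at least as fast as `B`; hence none reaches `B`
(`norm_sq_lt`). As `w` is only measurable, this is argued by integrating over a short interval
before the first contact, not by differentiating there.

The rates depend only on `κ`, `M`, `θ`, which gives uniformity over a family. For one network,
finiteness turns the strict constraints into such bounds. -/

/-- A function whose increments are controlled by those of an absolutely continuous function is
absolutely continuous. -/
theorem AbsolutelyContinuousOnInterval.of_dist_le {X Y : Type*} [PseudoMetricSpace X]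
    [PseudoMetricSpace Y] {f : ℝ → X} {G : ℝ → Y} {a b K : ℝ}
    (hG : AbsolutelyContinuousOnInterval G a b)
    (h : ∀ x ∈ uIcc a b, ∀ y ∈ uIcc a b, dist (f x) (f y) ≤ K * dist (G x) (G y)) :
    AbsolutelyContinuousOnInterval f a b := by
  unfold AbsolutelyContinuousOnInterval at *
  refine squeeze_zero' (g := fun E : ℕ × (ℕ → ℝ × ℝ) =>
    K * ∑ i ∈ Finset.range E.1, dist (G (E.2 i).1) (G (E.2 i).2)) ?_ ?_ ?_
  · exact Eventually.of_forall fun E => Finset.sum_nonneg fun _ _ => dist_nonneg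
  · have : ∀ᶠ (E : ℕ × (ℕ → ℝ × ℝ)) in totalLengthFilter ⊓ 𝓟 (disjWithin a b),
        E ∈ disjWithin a b := eventually_inf_principal.mpr (by simp)
    filter_upwards [this] with E hE
    rw [Finset.mul_sum]
    exact Finset.sum_le_sum fun i hi => h _ (hE.1 i hi).1 _ (hE.1 i hi).2
  · simpa using hG.const_mul K

/-- The fundamental theorem of calculus for a `C¹` function along a Carathéodory curve. -/
theorem ContDiff.integral_fderiv_along_curve {E : Type*} [NormedAddCommGroup E] [NormedSpace ℝ E]
    [CompleteSpace E] {V : E → ℝ} (hV : ContDiff ℝ 1 V) {e g : ℝ → E}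
    (he : ContinuousOn e (Ici 0))
    (hg : ∀ t, 0 ≤ t → IntervalIntegrable g volume 0 t)
    (heg : ∀ t, 0 ≤ t → e t = e 0 + ∫ s in (0 : ℝ)..t, g s) {a b : ℝ} (ha : 0 ≤ a) (hab : a ≤ b) :
    IntervalIntegrable (fun s => fderiv ℝ V (e s) (g s)) volume a b ∧
      V (e b) - V (e a) = ∫ s in a..b, fderiv ℝ V (e s) (g s) := by
  have hb : 0 ≤ b := ha.trans hab
  have hgb := hg b hb
  have hsub : uIcc a b ⊆ uIcc 0 b := by
    rw [uIcc_of_le hab, uIcc_of_le hb]; exact Icc_subset_Icc_left ha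
  have hcomp : IsCompact (e '' Icc 0 b) :=
    isCompact_Icc.image_of_continuousOn (he.mono Icc_subset_Ici_self)
  -- `V` is Lipschitz on the compact trajectory, so the increments of `V ∘ e` are controlled by
  -- those of the primitive of `‖g‖`.
  obtain ⟨K, hK⟩ := LocallyLipschitzOn.exists_lipschitzOnWith_of_compact hcomp
    (hV.locallyLipschitz.locallyLipschitzOn)
  have hAC0 : AbsolutelyContinuousOnInterval (fun t => V (e t)) 0 b := by
    refine (hgb.norm.absolutelyContinuousOnInterval_intervalIntegral
      (c := 0) left_mem_uIcc).of_dist_le (K := K) ?_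
    rw [uIcc_of_le hb]
    intro x hx y hy
    refine (hK.dist_le_mul _ (mem_image_of_mem e hx) _ (mem_image_of_mem e hy)).trans ?_
    refine mul_le_mul_of_nonneg_left ?_ K.2
    rw [heg x hx.1, heg y hy.1, dist_add_left, dist_eq_norm, dist_eq_norm,
      intervalIntegral.integral_interval_sub_left (hg x hx.1) (hg y hy.1),
      intervalIntegral.integral_interval_sub_left (hg x hx.1).norm (hg y hy.1).norm]
    exact intervalIntegral.norm_integral_le_abs_integral_norm
  have hAC := hAC0.mono hsub
  have hderiv : ∀ᵐ x, x ∈ uIoc a b → deriv (fun t => V (e t)) x = fderiv ℝ V (e x) (g x) := by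
    -- The integral formula for `e` holds only on `[0, ∞)`, so two-sided differentiation needs an
    -- interior time.
    have hne : ∀ᵐ x : ℝ, x ≠ 0 := by simp [ae_iff, measure_singleton]
    filter_upwards [hgb.ae_hasDerivAt_integral, hne] with x hx hx0 hxab
    have hxb : x ∈ uIcc 0 b := hsub (uIoc_subset_uIcc hxab)
    have hd := hx hxb 0 left_mem_uIcc
    rw [uIcc_of_le hb] at hxb
    have hpos : 0 < x := lt_of_le_of_ne hxb.1 hx0.symm
    have hde : HasDerivAt e (g x) x := by
      refine (hd.const_add (e 0)).congr_of_eventuallyEq ?_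
      filter_upwards [Ioi_mem_nhds hpos] with y hy using heg y (le_of_lt hy)
    exact (((hV.differentiable one_ne_zero) (e x)).hasFDerivAt.comp_hasDerivAt x hde).deriv
  constructor
  · refine hAC.intervalIntegrable_deriv.congr_ae ?_
    rw [Filter.EventuallyEq, ae_restrict_iff' measurableSet_uIoc]
    exact hderiv
  · rw [← hAC.integral_deriv_eq_sub]
    exact intervalIntegral.integral_congr_ae hderiv

/-- If the functions `f i`, negative at time zero, cannot vanish for the first time without
having been nonnegative before, then they stay negative. -/
theorem neg_of_forall_first_zero {ι : Type*} [Finite ι] {f : ι → ℝ → ℝ}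
    (hf : ∀ i, ContinuousOn (f i) (Ici 0)) (h0 : ∀ i, f i 0 < 0)
    (h : ∀ i t, 0 < t → (∀ j, ∀ s ∈ Icc 0 t, f j s ≤ 0) → f i t = 0 → ∃ a ∈ Ico 0 t, 0 ≤ f i a)
    (i : ι) {t : ℝ} (ht : 0 ≤ t) : f i t < 0 := by
  by_contra! hcon
  -- The times at which some `f j` is nonnegative: compact because there are finitely many `j`, so
  -- there is a first one.
  let C : Set ℝ := ⋃ j, {s ∈ Icc 0 t | 0 ≤ f j s}
  have hC : IsCompact C := by
    refine isCompact_iUnion fun j => isCompact_Icc.of_isClosed_subset ?_ fun s hs => hs.1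
    exact ContinuousOn.preimage_isClosed_of_isClosed
      ((hf j).mono Icc_subset_Ici_self) isClosed_Icc isClosed_Ici
  obtain ⟨τ, hτ⟩ := hC.exists_isLeast ⟨t, mem_iUnion.2 ⟨i, ⟨ht, le_rfl⟩, hcon⟩⟩
  obtain ⟨k, ⟨hτ0, hτt⟩, hkτ⟩ := mem_iUnion.1 hτ.1
  have hbefore : ∀ j, ∀ s ∈ Ico 0 τ, f j s < 0 := by
    intro j s hs
    by_contra! hj
    exact (hτ.2 (mem_iUnion.2 ⟨j, ⟨hs.1, hs.2.le.trans hτt⟩, hj⟩)).not_gt hs.2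
  have hτpos : 0 < τ := lt_of_le_of_ne hτ0 fun hz => (h0 k).not_ge (hz ▸ hkτ)
  have hle : ∀ j, ∀ s ∈ Icc 0 τ, f j s ≤ 0 := by
    intro j s hs
    have hcl : Icc 0 τ ⊆ closure (Ico 0 τ) := by rw [closure_Ico hτpos.ne]
    have hs' := hcl hs
    have := ((hf j) s hs.1).mono (Ico_subset_Icc_self.trans Icc_subset_Ici_self : Ico 0 τ ⊆ Ici 0)
    have : (𝓝[Ico 0 τ] s).NeBot := mem_closure_iff_nhdsWithin_neBot.1 hs'
    refine le_of_tendsto ‹ContinuousWithinAt (f j) (Ico 0 τ) s› ?_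
    filter_upwards [self_mem_nhdsWithin] with r hr using (hbefore j r hr).le
  obtain ⟨a, haτ, hfa⟩ := h k τ hτpos hle (le_antisymm (hle k τ ⟨hτ0, le_rfl⟩) hkτ)
  exact (hbefore k a haτ).not_ge hfa

/-- Global Carathéodory solutions of a linear equation with locally integrable forcing. -/
theorem exists_linear_caratheodory_solution {E : Type*} [NormedAddCommGroup E] [NormedSpace ℝ E]
    [CompleteSpace E] (F : E →L[ℝ] E) {w : ℝ → E} (hw : ∀ a b, IntervalIntegrable w volume a b)
    (x₀ : E) :
    ∃ e : ℝ → E, Continuous e ∧ e 0 = x₀ ∧ ∀ t, e t = x₀ + ∫ s in (0 : ℝ)..t, (F (e s) + w s) := by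
  let _ := NormedAlgebra.restrictScalars ℚ ℝ (E →L[ℝ] E)
  -- Substituting `e = y + W` removes the rough forcing: `y' = F (y + W)` has continuous data and is
  -- solved by variation of constants.
  let W : ℝ → E := fun t => ∫ s in (0 : ℝ)..t, w s
  have hW : Continuous W := intervalIntegral.continuous_primitive hw 0
  let Φ : ℝ → E →L[ℝ] E := fun t => NormedSpace.exp (t • F)
  have hΦ : ∀ t, HasDerivAt Φ (F * Φ t) t := fun t => hasDerivAt_exp_smul_const' F t
  have hΦc : Continuous Φ := continuous_iff_continuousAt.2 fun t => (hΦ t).continuousAt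
  have hΦinv : ∀ t, Φ t * Φ (-t) = 1 := by
    intro t
    simp only [Φ, neg_smul]
    rw [← NormedSpace.exp_add_of_commute ((Commute.refl (t • F)).neg_right), add_neg_cancel,
      NormedSpace.exp_zero]
  let k : ℝ → E := fun s => Φ (-s) (F (W s))
  have hk : Continuous k := (hΦc.comp continuous_neg).clm_apply (F.continuous.comp hW)
  let y : ℝ → E := fun t => Φ t (x₀ + ∫ s in (0 : ℝ)..t, k s)
  have hy : ∀ t, HasDerivAt y (F (y t + W t)) t := by
    intro t
    have h1 : HasDerivAt (fun t => x₀ + ∫ s in (0 : ℝ)..t, k s) (k t) t :=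
      (hk.integral_hasStrictDerivAt 0 t).hasDerivAt.const_add x₀
    have h2 := (hΦ t).clm_apply h1
    have h3 : Φ t (k t) = F (W t) := by
      have := congrArg (fun L : E →L[ℝ] E => L (F (W t))) (hΦinv t)
      simpa [k] using this
    rw [h3] at h2
    simpa [y, map_add] using h2
  have hyc : Continuous y := continuous_iff_continuousAt.2 fun t => (hy t).continuousAt
  have hΦ0 : Φ 0 = 1 := by simp [Φ, NormedSpace.exp_zero]
  have hy0 : y 0 = x₀ := by simp [y, hΦ0]
  have hFc : Continuous fun s => F (y s + W s) := F.continuous.comp (hyc.add hW)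
  refine ⟨fun t => y t + W t, hyc.add hW, by simp [hy0, W], fun t => ?_⟩
  rw [intervalIntegral.integral_add (hFc.intervalIntegrable 0 t) (hw 0 t),
    intervalIntegral.integral_eq_sub_of_hasDerivAt (fun s _ => hy s) (hFc.intervalIntegrable 0 t),
    hy0]
  simp only [W]
  abel

/-! ## Quadratic forms of symmetric matrices -/

namespace BodyMat

theorem op_mul (A B : BodyMat) (x : BodyState) : op (A * B) x = op A (op B x) := by
  simp [op, map_mul]

theorem op_add (A B : BodyMat) (x : BodyState) : op (A + B) x = op A x + op B x := by
  simp [op, map_add]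

theorem op_sub (A B : BodyMat) (x : BodyState) : op (A - B) x = op A x - op B x := by
  simp [op, map_sub]

theorem op_smul (c : ℝ) (A : BodyMat) (x : BodyState) : op (c • A) x = c • op A x := by
  simp [op, map_smul]

theorem op_one (x : BodyState) : op 1 x = x := by
  simp [op, map_one]

theorem inner_op_transpose (A : BodyMat) (x y : BodyState) :
    inner ℝ x (op A.transpose y) = inner ℝ (op A x) y := by
  have h : op A.transpose = ContinuousLinearMap.adjoint (op A) := by
    have := map_star (Matrix.toEuclideanCLM (n := BodyIdx) (𝕜 := ℝ)) A
    rw [ContinuousLinearMap.star_eq_adjoint, Matrix.star_eq_conjTranspose,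
      Matrix.conjTranspose_eq_transpose_of_trivial] at this
    exact this
  rw [h, ContinuousLinearMap.adjoint_inner_right]

theorem inner_op_symSum (A : BodyMat) (x : BodyState) :
    inner ℝ x (op (symSum A) x) = 2 * inner ℝ x (op A x) := by
  rw [symSum, op_add, inner_add_right, inner_op_transpose, real_inner_comm x (op A x)]
  ring

theorem inner_op_nonneg {A : BodyMat} (hA : A.PosSemidef) (x : BodyState) :
    0 ≤ inner ℝ x (op A x) := by
  have := hA.dotProduct_mulVec_nonneg x.ofLp
  simpa [op, EuclideanSpace.inner_eq_star_dotProduct, dotProduct_comm] using this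

theorem inner_op_comm {A : BodyMat} (hA : A.IsHermitian) (x y : BodyState) :
    inner ℝ x (op A y) = inner ℝ (op A x) y := by
  have h : A.transpose = A := by
    rw [← Matrix.conjTranspose_eq_transpose_of_trivial]; exact hA
  conv_lhs => rw [← h]
  exact inner_op_transpose A x y

theorem inner_op_le_of_posSemidef_sub {A : BodyMat} {c : ℝ} (h : (c • (1 : BodyMat) - A).PosSemidef)
    (x : BodyState) : inner ℝ x (op A x) ≤ c * ‖x‖ ^ 2 := by
  have := inner_op_nonneg h x
  rw [op_sub, op_smul, op_one, inner_sub_right, inner_smul_right, real_inner_self_eq_norm_sq]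
    at this
  linarith

theorem lambdaMin_mem_spectrum {A : BodyMat} (hA : A.IsHermitian) :
    lambdaMin A ∈ spectrum ℝ A := by
  refine Set.Nonempty.csInf_mem ?_ (Matrix.finite_real_spectrum)
  rw [hA.spectrum_real_eq_range_eigenvalues]
  exact range_nonempty _

theorem lambdaMin_pos {A : BodyMat} (hA : A.PosDef) : 0 < lambdaMin A := by
  have h := lambdaMin_mem_spectrum hA.isHermitian
  rw [hA.isHermitian.spectrum_real_eq_range_eigenvalues] at h
  obtain ⟨i, hi⟩ := h
  rw [← hi]
  exact hA.eigenvalues_pos i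

theorem lambdaMin_le_lambdaMax {A : BodyMat} (hA : A.IsHermitian) : lambdaMin A ≤ lambdaMax A :=
  le_csSup (Matrix.finite_real_spectrum).bddAbove (lambdaMin_mem_spectrum hA)

/-- The spectrum of `λ_max I - A` is `λ_max` minus that of `A`, hence nonnegative. -/
theorem inner_op_le_lambdaMax {A : BodyMat} (hA : A.IsHermitian) (x : BodyState) :
    inner ℝ x (op A x) ≤ lambdaMax A * ‖x‖ ^ 2 := by
  refine inner_op_le_of_posSemidef_sub
    (Matrix.posSemidef_iff_isHermitian_and_spectrum_nonneg.2 ⟨?_, ?_⟩) x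
  · exact (Matrix.isHermitian_one.smul (IsSelfAdjoint.all _)).sub hA
  · rw [← Algebra.algebraMap_eq_smul_one, ← spectrum.singleton_sub_eq]
    rintro _ ⟨_, rfl, s, hs, rfl⟩
    exact sub_nonneg.2 (le_csSup (Matrix.finite_real_spectrum).bddAbove hs)

theorem lambdaMin_mul_le_inner_op {A : BodyMat} (hA : A.IsHermitian) (x : BodyState) :
    lambdaMin A * ‖x‖ ^ 2 ≤ inner ℝ x (op A x) := by
  have h : ((-lambdaMin A) • (1 : BodyMat) - (-A)).PosSemidef := by
    refine Matrix.posSemidef_iff_isHermitian_and_spectrum_nonneg.2 ⟨?_, ?_⟩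
    · exact (Matrix.isHermitian_one.smul (IsSelfAdjoint.all _)).sub hA.neg
    · rw [neg_smul, sub_neg_eq_add, neg_add_eq_sub, ← Algebra.algebraMap_eq_smul_one,
        ← spectrum.sub_singleton_eq]
      rintro _ ⟨s, hs, _, rfl, rfl⟩
      exact sub_nonneg.2 (csInf_le (Matrix.finite_real_spectrum).bddBelow hs)
  have := inner_op_le_of_posSemidef_sub h x
  simp only [op, map_neg, neg_apply, inner_neg_right] at this ⊢
  linarith

/-- Young's inequality for the form of a positive semidefinite matrix. -/
theorem two_mul_inner_op_le {A : BodyMat} (hA : A.PosSemidef) {τ : ℝ} (hτ : 0 < τ)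
    (x y : BodyState) :
    2 * inner ℝ x (op A y) ≤ τ * inner ℝ x (op A x) + inner ℝ y (op A y) / τ := by
  -- Expand the form at `τ x - y` and divide by `τ`.
  have h := inner_op_nonneg hA (τ • x - y)
  rw [map_sub, map_smul, inner_sub_left, inner_sub_right, inner_sub_right, inner_smul_left,
    inner_smul_left, inner_smul_right, inner_smul_right, inner_op_comm hA.isHermitian y x,
    real_inner_comm x (op A y)] at h
  simp only [conj_trivial] at h
  rw [← sub_nonneg]
  have : τ * inner ℝ x (op A x) + inner ℝ y (op A y) / τ - 2 * inner ℝ x (op A y)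
      = (τ * (τ * inner ℝ x (op A x)) - τ * inner ℝ x (op A y) -
        (τ * inner ℝ x (op A y) - inner ℝ y (op A y))) / τ := by
    field_simp
    ring
  rw [this]
  exact div_nonneg h hτ.le

end BodyMat

/-! ## The linear matrix inequality -/

namespace DesignData

variable {N : ℕ} {S : DesignData N} {D : DesignVars N}

/-- This is a diagonal entry of the positive definite matrix. It makes `𝐗_p¹¹` invertible and rules
out `ν_i = 0`. -/
theorem Constraints.neg_p_mul_ν_pos (h : S.Constraints D) (i : Fin N) : 0 < -(D.p i * S.ν i) := by
  have := h.lmi.diag_pos (i := Sum.inl (Sum.inl (i, Sum.inl 0)))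
  simpa [lmiMatrix, Xp11, scalarBlocks] using this

theorem Constraints.closedLoop_K (h : S.Constraints D) (i j : Fin N) :
    (S.closedLoop D).K i j = (-(D.p i * S.ν i))⁻¹ • D.Q i j := by
  have hinv : (S.Xp11 D)⁻¹ = scalarBlocks fun i => (-(D.p i * S.ν i))⁻¹ := by
    refine Matrix.inv_eq_right_inv ?_
    rw [Xp11, scalarBlocks, scalarBlocks, Matrix.diagonal_mul_diagonal, ← Matrix.diagonal_one]
    congr 1
    funext ia
    exact mul_inv_cancel₀ (h.neg_p_mul_ν_pos ia.1).ne'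
  ext a b
  simp [closedLoop, hinv, scalarBlocks, stackBlocks, Matrix.diagonal_mul]

/-- Moving transposes across the dot product pairs the off-diagonal blocks; the two halves `1/(2ν)`
add up to `1/ν`. -/
theorem lmiMatrix_quadraticForm (S : DesignData N) (D : DesignVars N)
    (a b x u : Fin N × BodyIdx → ℝ) :
    star (Sum.elim (Sum.elim a b) (Sum.elim x u)) ⬝ᵥ
        (S.lmiMatrix D).mulVec (Sum.elim (Sum.elim a b) (Sum.elim x u)) =
      ∑ i, (-(D.p i.1 * S.ν i.1) * a i ^ 2 + 2 * a i * (stackBlocks D.Q).mulVec x i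
        - 2 * (D.p i.1 * S.ν i.1) * a i * u i + b i ^ 2 + 2 * b i * x i
        + 1 / S.ν i.1 * x i * (stackBlocks D.Q).mulVec x i + D.p i.1 * S.ρ i.1 * x i ^ 2
        - 1 / S.ν i.1 * (D.p i.1 * S.ν i.1) * x i * u i + D.γ ^ 2 * u i ^ 2) := by
  have hT : ∀ v, x ⬝ᵥ (stackBlocks D.Q).transpose.mulVec v =
      (stackBlocks D.Q).mulVec x ⬝ᵥ v := by
    intro v
    rw [Matrix.mulVec_transpose, dotProduct_comm, ← Matrix.dotProduct_mulVec, dotProduct_comm]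
  simp only [lmiMatrix, star_trivial, Matrix.fromBlocks_mulVec, ← Sum.elim_add_add, Sum.elim_comp_inl,
    Sum.elim_comp_inr, dotProduct_add, sumElim_dotProduct_sumElim, Matrix.sub_mulVec,
    Matrix.neg_mulVec, ← Matrix.mulVec_mulVec, dotProduct_sub, dotProduct_neg, hT,
    Matrix.smul_mulVec, Matrix.one_mulVec, Matrix.zero_mulVec]
  simp only [Xp11, Xp22, X12, X21, scalarBlocks, Matrix.diagonal_transpose, dotProduct,
    Matrix.mulVec_diagonal, Pi.smul_apply, Pi.zero_apply, smul_eq_mul,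
    ← Finset.sum_add_distrib, ← Finset.sum_sub_distrib, ← Finset.sum_neg_distrib]
  refine Finset.sum_congr rfl fun i _ => ?_
  ring

/-- The linear matrix inequality, evaluated along the closed loop, compares the weighted sum of the
supply rates of the subsystems with the supply rate of the network. -/
theorem Constraints.sum_supplyIFOFP_le (h : S.Constraints D) (e w : NetState N) :
    ∑ i, D.p i * supplyIFOFP (S.ν i) (S.ρ i) ((S.closedLoop D).input e w i) (e i) ≤
      supplyL2G D.γ w e := by
  set η : Fin N → BodyState := (S.closedLoop D).input e w with hη
  have hstack : ∀ ia : Fin N × BodyIdx,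
      (stackBlocks D.Q).mulVec (fun jb => e jb.1 jb.2) ia =
        -(D.p ia.1 * S.ν ia.1) * (η ia.1 ia.2 - w ia.1 ia.2) := by
    rintro ⟨i, a⟩
    have hP := (h.neg_p_mul_ν_pos i).ne'
    simp only [hη, ErrorNetwork.input, h.closedLoop_K, BodyMat.op_smul, ← Finset.smul_sum,
      PiLp.add_apply, PiLp.smul_apply, smul_eq_mul, add_sub_cancel_right]
    rw [mul_inv_cancel_left₀ hP]
    simp [Matrix.mulVec, dotProduct, stackBlocks, Fintype.sum_prod_type, BodyMat.op]
  -- For given `x = e` and `u = w`, the first two components `-η`, `-e` minimise the form: this is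
  -- the Schur complement in explicit shape.
  have hpos := h.lmi.posSemidef.dotProduct_mulVec_nonneg
    (Sum.elim (Sum.elim (fun ia => -η ia.1 ia.2) (fun ia => -e ia.1 ia.2))
      (Sum.elim (fun ia => e ia.1 ia.2) (fun ia => w ia.1 ia.2)))
  have key : ∑ ia : Fin N × BodyIdx, (D.p ia.1 * (-S.ν ia.1 * η ia.1 ia.2 ^ 2
      + η ia.1 ia.2 * e ia.1 ia.2 - S.ρ ia.1 * e ia.1 ia.2 ^ 2)) ≤
      ∑ ia : Fin N × BodyIdx, (D.γ ^ 2 * w ia.1 ia.2 ^ 2 - e ia.1 ia.2 ^ 2) := by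
    rw [← sub_nonneg, ← Finset.sum_sub_distrib]
    refine hpos.trans_eq ?_
    rw [lmiMatrix_quadraticForm]
    refine Finset.sum_congr rfl fun ia _ => ?_
    have hν : S.ν ia.1 ≠ 0 := by
      intro h0
      simpa [h0] using h.neg_p_mul_ν_pos ia.1
    rw [hstack]
    field_simp
    ring
  simp only [Fintype.sum_prod_type] at key
  convert key using 1
  · refine Finset.sum_congr rfl fun i _ => ?_
    rw [← Finset.mul_sum, Finset.sum_sub_distrib, Finset.sum_add_distrib, ← Finset.mul_sum,
      ← Finset.mul_sum, supplyIFOFP, EuclideanSpace.real_norm_sq_eq,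
      EuclideanSpace.real_norm_sq_eq]
    simp only [EuclideanSpace.inner_eq_star_dotProduct, dotProduct, star_trivial]
    simp [mul_comm]
  · simp only [supplyL2G, PiLp.norm_sq_eq_of_L2, Finset.mul_sum, ← Finset.sum_sub_distrib,
      Real.norm_eq_abs, sq_abs]

end DesignData

theorem fderiv_sum_const_mul_comp {ι E F : Type*} [Fintype ι] [NormedAddCommGroup E]
    [NormedSpace ℝ E] [NormedAddCommGroup F] [NormedSpace ℝ F] (p : ι → ℝ) {V : ι → F → ℝ}
    (hV : ∀ i, Differentiable ℝ (V i)) (A : ι → E →L[ℝ] F) (x v : E) :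
    fderiv ℝ (fun x => ∑ i, p i * V i (A i x)) x v =
      ∑ i, p i * fderiv ℝ (V i) (A i x) (A i v) := by
  have h : HasFDerivAt (fun x => ∑ i, p i * V i (A i x))
      (∑ i, p i • (fderiv ℝ (V i) (A i x)).comp (A i)) x :=
    HasFDerivAt.fun_sum fun i _ =>
      ((hV i (A i x)).hasFDerivAt.comp x (A i).hasFDerivAt).const_mul (p i)
  rw [h.fderiv]
  simp

/-! ## The closed-loop network as a linear system -/

namespace ErrorNetwork

variable {N : ℕ}

theorem field_apply_eq_add (net : ErrorNetwork N) (e w : NetState N) (i : Fin N) :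
    net.field e w i = BodyMat.op (outerA + outerB * net.Lbar i) (e i) +
      (∑ j, BodyMat.op (net.K i j) (e j) + w i) := rfl

/-- The state of one agent, as a linear map of the state of the network. -/
noncomputable def agent (i : Fin N) : NetState N →L[ℝ] BodyState :=
  PiLp.proj (𝕜 := ℝ) 2 (fun _ : Fin N => BodyState) i

theorem agent_apply (i : Fin N) (e : NetState N) : agent i e = e i := rfl

/-- The state matrix of the network, as a linear map. -/
noncomputable def stateMap (net : ErrorNetwork N) : NetState N →L[ℝ] NetState N :=
  ((PiLp.continuousLinearEquiv 2 ℝ (fun _ : Fin N => BodyState)).symm :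
    (Fin N → BodyState) →L[ℝ] NetState N).comp
    (ContinuousLinearMap.pi fun i =>
      (BodyMat.op (outerA + outerB * net.Lbar i)).comp (agent i) +
        ∑ j, (BodyMat.op (net.K i j)).comp (agent j))

theorem stateMap_apply (net : ErrorNetwork N) (e : NetState N) (i : Fin N) :
    net.stateMap e i = BodyMat.op (outerA + outerB * net.Lbar i) (e i) +
      ∑ j, BodyMat.op (net.K i j) (e j) := by
  change ((BodyMat.op (outerA + outerB * net.Lbar i)).comp (agent i) +
        ∑ j, (BodyMat.op (net.K i j)).comp (agent j)) e = _
  simp [agent_apply]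

theorem field_eq_stateMap_add (net : ErrorNetwork N) (e w : NetState N) :
    net.field e w = net.stateMap e + w := by
  ext i : 1
  rw [PiLp.add_apply, stateMap_apply, field_apply_eq_add, add_assoc]

theorem field_zero (net : ErrorNetwork N) : net.field 0 0 = 0 := by
  rw [field_eq_stateMap_add, map_zero, add_zero]

/-- A solution has an integrable right-hand side, and the state part of it is continuous. -/
theorem IsSolution.intervalIntegrable_disturbance {net : ErrorNetwork N} {w e : ℝ → NetState N}
    (h : net.IsSolution w e) {t : ℝ} (ht : 0 ≤ t) : IntervalIntegrable w volume 0 t := by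
  have h1 : IntervalIntegrable (fun s => net.stateMap (e s)) volume 0 t := by
    refine ContinuousOn.intervalIntegrable (net.stateMap.continuous.comp_continuousOn ?_)
    rw [uIcc_of_le ht]
    exact h.1.mono Icc_subset_Ici_self
  exact ((h.2 t ht).1.sub h1).congr fun s _ => by simp [field_eq_stateMap_add]

theorem IsSolution.integral_fderiv {net : ErrorNetwork N} {w e : ℝ → NetState N}
    (h : net.IsSolution w e) {V : NetState N → ℝ} (hV : ContDiff ℝ 1 V) {a b : ℝ} (ha : 0 ≤ a)
    (hab : a ≤ b) :
    IntervalIntegrable (fun s => fderiv ℝ V (e s) (net.field (e s) (w s))) volume a b ∧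
      V (e b) - V (e a) = ∫ s in a..b, fderiv ℝ V (e s) (net.field (e s) (w s)) :=
  hV.integral_fderiv_along_curve h.1 (fun t ht => (h.2 t ht).1) (fun t ht => (h.2 t ht).2) ha hab

/-- Solutions exist for every essentially bounded disturbance. -/
theorem exists_isSolution (net : ErrorNetwork N) {w : ℝ → NetState N}
    (hw : AEStronglyMeasurable w (volume.restrict (Ici 0))) {C : ℝ}
    (hC : ∀ t, 0 ≤ t → ‖w t‖ ≤ C) (e₀ : NetState N) :
    ∃ e, net.IsSolution w e ∧ e 0 = e₀ := by
  -- Extending `w` by zero to negative times makes it locally integrable on the whole line.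
  have hloc : ∀ a b, IntervalIntegrable ((Ici (0 : ℝ)).indicator w) volume a b := by
    intro a b
    have hm : AEStronglyMeasurable ((Ici (0 : ℝ)).indicator w) volume :=
      (aestronglyMeasurable_indicator_iff measurableSet_Ici).2 hw
    refine (intervalIntegrable_const (c := max C 0)).mono_fun hm.restrict
      (Eventually.of_forall fun t => ?_)
    rw [Real.norm_of_nonneg (le_max_right _ _)]
    change ‖(Ici (0 : ℝ)).indicator w t‖ ≤ max C 0
    by_cases ht : t ∈ Ici (0 : ℝ)
    · rw [indicator_of_mem ht]
      exact (hC t ht).trans (le_max_left _ _)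
    · rw [indicator_of_notMem ht]
      simp
  obtain ⟨e, hec, he0, he⟩ := exists_linear_caratheodory_solution net.stateMap hloc e₀
  have heq : ∀ t, 0 ≤ t → EqOn (fun s => net.stateMap (e s) + (Ici (0 : ℝ)).indicator w s)
      (fun s => net.field (e s) (w s)) (uIcc 0 t) := by
    intro t ht s hs
    rw [uIcc_of_le ht] at hs
    simp only [field_eq_stateMap_add, indicator_of_mem (show s ∈ Ici (0 : ℝ) from hs.1)]
  refine ⟨e, ⟨hec.continuousOn, fun t ht => ⟨?_, ?_⟩⟩, he0⟩
  · exact (((net.stateMap.continuous.comp hec).intervalIntegrable 0 t).add (hloc 0 t)).congr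
      ((heq t ht).mono uIoc_subset_uIcc)
  · rw [he t, he0, intervalIntegral.integral_congr (heq t ht)]

/-! ## Finite-gain stability -/

/-- The integrated dissipation inequality on a bounded interval. -/
theorem IsSolution.lintegral_sq_le {net : ErrorNetwork N} {w e : ℝ → NetState N}
    (h : net.IsSolution w e) {γ : ℝ} (hγ : 0 < γ) {V : NetState N → ℝ} (hV : ContDiff ℝ 1 V)
    (hVnn : ∀ x, 0 ≤ V x) (hdiss : ∀ x u, fderiv ℝ V x (net.field x u) ≤ supplyL2G γ u x)
    {T : ℝ} (hT : 0 ≤ T) :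
    ∫⁻ t in Icc 0 T, ‖e t‖ₑ ^ 2 ≤
      ENNReal.ofReal γ ^ 2 * (∫⁻ t in Icc 0 T, ‖w t‖ₑ ^ 2) + ENNReal.ofReal (V (e 0)) := by
  have hIoc : volume.restrict (Icc 0 T) = volume.restrict (Ioc 0 T) :=
    (Measure.restrict_congr_set Ioc_ae_eq_Icc).symm
  have hsq : ∀ f : ℝ → NetState N, ∀ t, ‖f t‖ₑ ^ 2 = ENNReal.ofReal (‖f t‖ ^ 2) := by
    intro f t
    rw [ENNReal.ofReal_pow (norm_nonneg _), ofReal_norm]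
  -- If `w` has infinite energy on `[0, T]`, the right side is infinite because `γ > 0`; otherwise
  -- all integrals are real.
  by_cases hfin : ∫⁻ t in Icc 0 T, ‖w t‖ₑ ^ 2 = ⊤
  · rw [hfin, ENNReal.mul_top (by positivity), top_add]
    exact le_top
  have hwm : AEStronglyMeasurable w (volume.restrict (Icc 0 T)) := by
    rw [hIoc]
    exact ((intervalIntegrable_iff_integrableOn_Ioc_of_le hT).1
      (h.intervalIntegrable_disturbance hT)).aestronglyMeasurable
  have hw2 : Integrable (fun t => ‖w t‖ ^ 2) (volume.restrict (Icc 0 T)) := by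
    refine ⟨hwm.norm.pow 2, ?_⟩
    rw [hasFiniteIntegral_iff_ofReal (Eventually.of_forall fun t => by positivity)]
    simpa only [hsq] using lt_top_iff_ne_top.2 hfin
  have he2 : Integrable (fun t => ‖e t‖ ^ 2) (volume.restrict (Icc 0 T)) :=
    ((h.1.mono Icc_subset_Ici_self).norm.pow 2).integrableOn_Icc
  simp only [hsq]
  rw [← ofReal_integral_eq_lintegral_ofReal he2 (Eventually.of_forall fun t => by positivity),
    ← ofReal_integral_eq_lintegral_ofReal hw2 (Eventually.of_forall fun t => by positivity),
    ← ENNReal.ofReal_pow hγ.le, ← ENNReal.ofReal_mul (by positivity),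
    ← ENNReal.ofReal_add (mul_nonneg (by positivity) (integral_nonneg fun t => by positivity))
      (hVnn _)]
  refine ENNReal.ofReal_le_ofReal ?_
  obtain ⟨hint, hftc⟩ := h.integral_fderiv hV le_rfl hT
  rw [intervalIntegral.integral_of_le hT, ← hIoc] at hftc
  rw [intervalIntegrable_iff_integrableOn_Ioc_of_le hT, IntegrableOn, ← hIoc] at hint
  have hmono := integral_mono hint ((hw2.const_mul (γ ^ 2)).sub he2)
    fun t => hdiss (e t) (w t)
  rw [integral_sub' (hw2.const_mul _) he2, integral_const_mul] at hmono
  have := hVnn (e T)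
  linarith

/-- Subadditivity of the square root splits the integrated inequality, with bias `√(V (e 0))`. The
half-line is exhausted by the intervals `[0, n]`. -/
theorem isL2Stable_of_isDissipative {net : ErrorNetwork N} {γ : ℝ} (hγ : 0 < γ)
    (hdiss : IsDissipative net.field net.output (supplyL2G γ)) : net.IsL2Stable γ := by
  refine ⟨hdiss, ?_⟩
  obtain ⟨-, -, V, hV, hV0, hVpos, hVd⟩ := hdiss
  have hVnn : ∀ x, 0 ≤ V x := fun x => by
    rcases eq_or_ne x 0 with rfl | hx
    exacts [hV0.ge, (hVpos x hx).le]
  refine ⟨fun x => (√(V x)).toNNReal, by simp [hV0], fun w e h I hI => ?_⟩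
  have hbdd : ∀ T, 0 ≤ T → ∫⁻ t in Icc 0 T, ‖e t‖ₑ ^ 2 ≤
      ENNReal.ofReal γ ^ 2 * (∫⁻ t in Icc 0 T, ‖w t‖ₑ ^ 2) + ENNReal.ofReal (V (e 0)) :=
    fun T hT => h.lintegral_sq_le hγ hV hVnn hVd hT
  have hsq : ∫⁻ t in I, ‖e t‖ₑ ^ 2 ≤
      ENNReal.ofReal γ ^ 2 * (∫⁻ t in I, ‖w t‖ₑ ^ 2) + ENNReal.ofReal (V (e 0)) := by
    rcases hI with ⟨T, hT, rfl⟩ | rfl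
    · exact hbdd T hT
    · have hU : Ici (0 : ℝ) = ⋃ n : ℕ, Icc (0 : ℝ) n := by
        ext t
        simp only [mem_Ici, mem_iUnion, mem_Icc, exists_and_left]
        exact ⟨fun ht => ⟨ht, exists_nat_ge t⟩, fun ht => ht.1⟩
      have hdir : Directed (· ⊆ ·) fun n : ℕ => Icc (0 : ℝ) n :=
        (monotone_nat_of_le_succ fun n => Icc_subset_Icc_right (by simp)).directed_le
      conv_lhs => rw [hU]
      rw [setLIntegral_iUnion_of_directed _ hdir]
      refine iSup_le fun n => (hbdd n n.cast_nonneg).trans ?_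
      gcongr
      exact Icc_subset_Ici_self
  have hnorm : ∀ f : ℝ → NetState N, eLpNorm f 2 (volume.restrict I) =
      (∫⁻ t in I, ‖f t‖ₑ ^ 2) ^ (1 / 2 : ℝ) := by
    intro f
    rw [eLpNorm_eq_lintegral_rpow_enorm_toReal two_ne_zero ENNReal.ofNat_ne_top]
    simp
  simp only [output]
  rw [hnorm, hnorm]
  calc (∫⁻ t in I, ‖e t‖ₑ ^ 2) ^ (1 / 2 : ℝ)
      ≤ (ENNReal.ofReal γ ^ 2 * (∫⁻ t in I, ‖w t‖ₑ ^ 2) + ENNReal.ofReal (V (e 0))) ^ (1 / 2 : ℝ) :=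
        ENNReal.rpow_le_rpow hsq (by norm_num)
    _ ≤ (ENNReal.ofReal γ ^ 2 * (∫⁻ t in I, ‖w t‖ₑ ^ 2)) ^ (1 / 2 : ℝ) +
        ENNReal.ofReal (V (e 0)) ^ (1 / 2 : ℝ) :=
        ENNReal.rpow_add_le_add_rpow _ _ (by norm_num : (0 : ℝ) ≤ 1 / 2) (by norm_num)
    _ = _ := by
        rw [ENNReal.mul_rpow_of_nonneg _ _ (by norm_num), ← ENNReal.rpow_natCast,
          ← ENNReal.rpow_mul, ENNReal.ofReal_rpow_of_nonneg (hVnn _) (by norm_num),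
          ← Real.sqrt_eq_rpow]
        norm_num
        rfl

end ErrorNetwork

namespace DesignData

variable {N : ℕ} {S : DesignData N} {D : DesignVars N}

theorem Constraints.isDissipative_closedLoop (h : S.Constraints D) (hS : S.LocalLoops) :
    IsDissipative (S.closedLoop D).field (S.closedLoop D).output (supplyL2G D.γ) := by
  refine ⟨(S.closedLoop D).field_zero, rfl, ?_⟩
  choose V hV hV0 hVpos hVd using fun i => (hS.ifofp i).2.2
  have hnn : ∀ i x, 0 ≤ V i x := fun i x => by
    rcases eq_or_ne x 0 with rfl | hx
    exacts [(hV0 i).ge, (hVpos i x hx).le]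
  refine ⟨fun x => ∑ i, D.p i * V i (x i), ?_, ?_, ?_, ?_⟩
  · exact ContDiff.sum fun i _ => contDiff_const.mul
      ((hV i).comp (ErrorNetwork.agent i).contDiff)
  · simp [hV0]
  · intro x hx
    obtain ⟨i, hi⟩ : ∃ i, x i ≠ 0 := by
      by_contra! hcon
      exact hx (by ext i : 1; simp [hcon])
    exact Finset.sum_pos' (fun j _ => mul_nonneg (h.p_pos j).le (hnn j _))
      ⟨i, Finset.mem_univ i, mul_pos (h.p_pos i) (hVpos i _ hi)⟩
  · intro x u
    refine (fderiv_sum_const_mul_comp D.p (fun i => (hV i).differentiable one_ne_zero)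
      ErrorNetwork.agent x _).trans_le ((Finset.sum_le_sum fun i _ => ?_).trans
        (h.sum_supplyIFOFP_le x u))
    exact mul_le_mul_of_nonneg_left (hVd i _ _) (h.p_pos i).le

end DesignData

/-! ## Scalable mesh stability -/

theorem contDiff_quadraticForm_comp {E F : Type*} [NormedAddCommGroup E] [NormedSpace ℝ E]
    [NormedAddCommGroup F] [InnerProductSpace ℝ F] (A : E →L[ℝ] F) (R : F →L[ℝ] F) :
    ContDiff ℝ 1 fun x => inner ℝ (A x) (R (A x)) :=
  A.contDiff.inner ℝ (R.contDiff.comp A.contDiff)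

theorem fderiv_quadraticForm_comp {E F : Type*} [NormedAddCommGroup E] [NormedSpace ℝ E]
    [NormedAddCommGroup F] [InnerProductSpace ℝ F] (A : E →L[ℝ] F) {R : F →L[ℝ] F}
    (hR : ∀ x y, inner ℝ x (R y) = inner ℝ (R x) y) (x v : E) :
    fderiv ℝ (fun x => inner ℝ (A x) (R (A x))) x v = 2 * inner ℝ (A x) (R (A v)) := by
  have h := A.hasFDerivAt (x := x) |>.inner ℝ ((R.comp A).hasFDerivAt (x := x))
  have h' : HasFDerivAt (fun x => inner ℝ (A x) (R (A x))) _ x := h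
  rw [h'.fderiv]
  simp only [ContinuousLinearMap.comp_apply, ContinuousLinearMap.prod_apply,
    fderivInnerCLM_apply]
  rw [hR (A v) (A x), real_inner_comm (A x) (R (A v))]
  ring

/-! ### Energy of one agent along the closed loop -/

namespace DesignData

variable {N : ℕ} {S : DesignData N} {D : DesignVars N}

theorem LocalLoops.two_mul_inner_op_stateMatrix_le (hS : S.LocalLoops) (i : Fin N)
    (x : BodyState) :
    2 * inner ℝ x (BodyMat.op (S.R i) (BodyMat.op (outerA + outerB * S.Lbar i) x)) ≤
      -S.ρ i * ‖x‖ ^ 2 := by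
  have h := BodyMat.inner_op_le_of_posSemidef_sub (hS.lyapunov i) x
  rw [BodyMat.inner_op_symSum, BodyMat.op_mul, BodyMat.inner_op_transpose] at h
  rwa [BodyMat.inner_op_comm (hS.R_posDef i).isHermitian, real_inner_comm]

theorem Constraints.two_mul_inner_op_diag_le (h : S.Constraints D) (i : Fin N) (x : BodyState) :
    2 * inner ℝ x (BodyMat.op (S.R i) (BodyMat.op ((S.closedLoop D).K i i) x)) ≤
      -S.ε i * ‖x‖ ^ 2 := by
  have hP := h.neg_p_mul_ν_pos i
  have h1 := BodyMat.inner_op_le_of_posSemidef_sub (h.diag_block i) x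
  rw [BodyMat.inner_op_symSum, BodyMat.op_mul] at h1
  rw [h.closedLoop_K, BodyMat.op_smul, map_smul, inner_smul_right]
  calc _ = (-(D.p i * S.ν i))⁻¹ *
        (2 * inner ℝ x (BodyMat.op (S.R i) (BodyMat.op (D.Q i i) x))) := by ring
    _ ≤ (-(D.p i * S.ν i))⁻¹ * (D.p i * S.ν i * S.ε i * ‖x‖ ^ 2) :=
        mul_le_mul_of_nonneg_left h1 (inv_pos.2 hP).le
    _ = -((-(D.p i * S.ν i))⁻¹ * -(D.p i * S.ν i)) * (S.ε i * ‖x‖ ^ 2) := by ring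
    _ = _ := by rw [inv_mul_cancel₀ hP.ne']; ring

/-- Only the row sum of the norms `‖R_i Q_ij‖` enters, against a common bound `s` for all agents, so
the number of neighbours plays no role. -/
theorem Constraints.sum_inner_op_offDiag_le (h : S.Constraints D) {i : Fin N} {θ s : ℝ}
    (hs : 0 ≤ s) (hθ : S.couplingSum D i ≤ θ * -(D.p i * S.ν i * S.δ i)) {e : NetState N}
    (he : ∀ j, ‖e j‖ ≤ s) (x : BodyState) :
    ∑ j ∈ Finset.univ.erase i,
        inner ℝ x (BodyMat.op (S.R i) (BodyMat.op ((S.closedLoop D).K i j) (e j))) ≤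
      θ * S.δ i * ‖x‖ * s := by
  have hP := h.neg_p_mul_ν_pos i
  calc _ ≤ ∑ j ∈ Finset.univ.erase i,
        specNorm (S.R i * D.Q i j) * ((-(D.p i * S.ν i))⁻¹ * ‖x‖ * s) := by
        refine Finset.sum_le_sum fun j _ => ?_
        rw [h.closedLoop_K, BodyMat.op_smul, map_smul, inner_smul_right, ← BodyMat.op_mul]
        calc _ ≤ (-(D.p i * S.ν i))⁻¹ * (‖x‖ * (specNorm (S.R i * D.Q i j) * s)) := by
              refine mul_le_mul_of_nonneg_left ?_ (inv_pos.2 hP).le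
              refine (real_inner_le_norm _ _).trans
                (mul_le_mul_of_nonneg_left ?_ (norm_nonneg x))
              exact (ContinuousLinearMap.le_opNorm _ _).trans
                (mul_le_mul_of_nonneg_left (he j) (norm_nonneg _))
          _ = _ := by ring
    _ = S.couplingSum D i * ((-(D.p i * S.ν i))⁻¹ * ‖x‖ * s) := by
        rw [couplingSum, Finset.sum_mul]
    _ ≤ θ * -(D.p i * S.ν i * S.δ i) * ((-(D.p i * S.ν i))⁻¹ * ‖x‖ * s) :=
        mul_le_mul_of_nonneg_right hθ
          (mul_nonneg (mul_nonneg (inv_pos.2 hP).le (norm_nonneg x)) hs)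
    _ = (-(D.p i * S.ν i) * (-(D.p i * S.ν i))⁻¹) * (θ * S.δ i * ‖x‖ * s) := by ring
    _ = _ := by rw [mul_inv_cancel₀ hP.ne', one_mul]

theorem LocalLoops.μ_pos (hS : S.LocalLoops) (i : Fin N) : 0 < S.μ i :=
  pos_of_mul_pos_left (Real.sqrt_pos.1 (hS.δ_pos i))
    (BodyMat.lambdaMin_pos (hS.R_posDef i)).le

theorem LocalLoops.δ_sq (hS : S.LocalLoops) (i : Fin N) :
    S.δ i ^ 2 = S.μ i * lambdaMin (S.R i) :=
  Real.sq_sqrt (mul_nonneg (hS.μ_pos i).le (BodyMat.lambdaMin_pos (hS.R_posDef i)).le)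

theorem LocalLoops.μ_mul_lambdaMax (hS : S.LocalLoops) (i : Fin N) :
    S.μ i * lambdaMax (S.R i) = S.ρ i + S.ε i - 1 :=
  div_mul_cancel₀ _ ((BodyMat.lambdaMin_pos (hS.R_posDef i)).trans_le
    (BodyMat.lambdaMin_le_lambdaMax (hS.R_posDef i).isHermitian)).ne'

/-- The derivative of `e_iᵀ R_i e_i` along the closed loop. -/
theorem Constraints.two_mul_inner_op_field_le (h : S.Constraints D) (hS : S.LocalLoops) {i : Fin N}
    {θ B ω τ : ℝ} (hτ : 0 < τ) (hB : 0 ≤ B)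
    (hθ : S.couplingSum D i ≤ θ * -(D.p i * S.ν i * S.δ i)) {e w : NetState N}
    (he : ∀ j, ‖e j‖ ^ 2 ≤ B) (hw : ‖w i‖ ≤ ω) :
    2 * inner ℝ (e i) (BodyMat.op (S.R i) ((S.closedLoop D).field e w i)) ≤
      -(S.μ i - τ) * inner ℝ (e i) (BodyMat.op (S.R i) (e i)) +
        θ ^ 2 * S.μ i * lambdaMin (S.R i) * B + lambdaMax (S.R i) * ω ^ 2 / τ := by
  have hR := hS.R_posDef i
  have hmax : 0 ≤ lambdaMax (S.R i) := (BodyMat.lambdaMin_pos hR).le.trans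
    (BodyMat.lambdaMin_le_lambdaMax hR.isHermitian)
  rw [ErrorNetwork.field_apply_eq_add, ← Finset.add_sum_erase _ _ (Finset.mem_univ i), map_add,
    map_add, map_add, map_sum, inner_add_right, inner_add_right, inner_add_right, inner_sum]
  have h1 := hS.two_mul_inner_op_stateMatrix_le i (e i)
  have h2 := h.two_mul_inner_op_diag_le i (e i)
  have h3 := h.sum_inner_op_offDiag_le (Real.sqrt_nonneg B) hθ
    (fun j => Real.le_sqrt_of_sq_le (he j)) (e i)
  have h4 := BodyMat.two_mul_inner_op_le hR.posSemidef hτ (e i) (w i)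
  have h5 : inner ℝ (w i) (BodyMat.op (S.R i) (w i)) / τ ≤ lambdaMax (S.R i) * ω ^ 2 / τ := by
    refine div_le_div_of_nonneg_right
      ((BodyMat.inner_op_le_lambdaMax hR.isHermitian _).trans ?_) hτ.le
    gcongr
  -- Young's inequality: the term `‖e i‖²` is paid for by the `-1` in `μ_i`, and `δ_i² = μ_i
  -- λ_min(R_i)` produces the rest.
  have h6 : 2 * (θ * S.δ i * ‖e i‖ * √B) ≤
      ‖e i‖ ^ 2 + θ ^ 2 * S.μ i * lambdaMin (S.R i) * B := by
    have hsq := sq_nonneg (‖e i‖ - θ * S.δ i * √B)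
    have heq : (θ * S.δ i * √B) ^ 2 = θ ^ 2 * S.μ i * lambdaMin (S.R i) * B := by
      rw [mul_pow, mul_pow, hS.δ_sq, Real.sq_sqrt hB]
      ring
    rw [← heq]
    linarith
  -- The remaining decay `(ρ_i + ε_i - 1)‖e i‖² = μ_i λ_max(R_i)‖e i‖²` dominates `μ_i q_i`.
  have h7 := mul_le_mul_of_nonneg_left
    (BodyMat.inner_op_le_lambdaMax hR.isHermitian (e i)) (hS.μ_pos i).le
  rw [← mul_assoc, hS.μ_mul_lambdaMax] at h7
  change 2 * (inner ℝ (e i) (BodyMat.op (S.R i) (BodyMat.op (outerA + outerB * S.Lbar i) (e i)))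
    + _) ≤ _
  linarith

/-- The derivative of `e_iᵀ R_i e_i` when the energy of agent `i` is almost maximal. -/
theorem Constraints.two_mul_inner_op_field_le_of_near_max (h : S.Constraints D)
    (hS : S.LocalLoops) {i : Fin N} {κ M θ B ω : ℝ} (hκ : 0 < κ) (hθ0 : 0 ≤ θ) (hθ1 : θ < 1)
    (hB : 0 ≤ B) (hmin : κ ≤ lambdaMin (S.R i)) (hmax : lambdaMax (S.R i) ≤ M) (hμ : κ ≤ S.μ i)
    (hθ : S.couplingSum D i ≤ θ * -(D.p i * S.ν i * S.δ i)) {e w : NetState N}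
    (he : ∀ j, ‖e j‖ ^ 2 ≤ B) (hw : ‖w i‖ ≤ ω)
    (hnear : lambdaMin (S.R i) * ((1 - (1 - θ ^ 2) / 4) * B) ≤
      inner ℝ (e i) (BodyMat.op (S.R i) (e i))) :
    2 * inner ℝ (e i) (BodyMat.op (S.R i) ((S.closedLoop D).field e w i)) ≤
      lambdaMin (S.R i) * (S.μ i * ((1 - θ ^ 2) / 2 *
        (8 * M / ((1 - θ ^ 2) ^ 2 * κ ^ 3) * ω ^ 2 - B))) := by
  have hμpos := hS.μ_pos i
  have hlpos := BodyMat.lambdaMin_pos (hS.R_posDef i)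
  obtain ⟨σ, hσ⟩ : ∃ σ, σ = 1 - θ ^ 2 := ⟨_, rfl⟩
  have hσ0 : 0 < σ := by rw [hσ]; nlinarith
  have hσ1 : σ ≤ 1 := by rw [hσ]; nlinarith
  -- With `τ = μ_i σ / 4` the coefficient of `μ_i λ_min(R_i) B` is `-(1 - σ/4)² + (1 - σ) = -σ/2 -
  -- σ²/16`; the last term is discarded through `h3`.
  have hτ : 0 < S.μ i * σ / 4 := by positivity
  have hmain := h.two_mul_inner_op_field_le hS hτ hB hθ he hw
  rw [← hσ] at hnear ⊢
  rw [show θ ^ 2 = 1 - σ by rw [hσ]; ring] at hmain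
  set l := lambdaMin (S.R i)
  set q := inner ℝ (e i) (BodyMat.op (S.R i) (e i))
  have hM0 : 0 ≤ M := hlpos.le.trans
    ((BodyMat.lambdaMin_le_lambdaMax (hS.R_posDef i).isHermitian).trans hmax)
  have h1 : -(S.μ i - S.μ i * σ / 4) * q ≤ -(S.μ i * (1 - σ / 4)) * (l * ((1 - σ / 4) * B)) := by
    rw [show -(S.μ i - S.μ i * σ / 4) = -(S.μ i * (1 - σ / 4)) by ring]
    exact mul_le_mul_of_nonpos_left hnear
      (neg_nonpos.2 (mul_nonneg hμpos.le (by linarith)))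
  have h2 : lambdaMax (S.R i) * ω ^ 2 / (S.μ i * σ / 4) ≤
      l * (S.μ i * (σ / 2 * (8 * M / (σ ^ 2 * κ ^ 3) * ω ^ 2))) := by
    rw [div_le_iff₀ hτ]
    have hpow : κ ^ 3 ≤ l * S.μ i ^ 2 := by
      calc κ ^ 3 = κ * κ ^ 2 := by ring
        _ ≤ l * S.μ i ^ 2 := by gcongr
    calc lambdaMax (S.R i) * ω ^ 2 ≤ M * ω ^ 2 := by gcongr
      _ = κ ^ 3 * (M * ω ^ 2 / κ ^ 3) := by field_simp
      _ ≤ l * S.μ i ^ 2 * (M * ω ^ 2 / κ ^ 3) := by gcongr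
      _ = _ := by field_simp; ring
  have h3 : 0 ≤ S.μ i * l * (σ ^ 2 / 16 * B) := by positivity
  linarith

/-- The comparison estimate: the squared error of every agent decays exponentially up to a term
proportional to the square of the disturbance bound. -/
theorem Constraints.norm_sq_lt (h : S.Constraints D) (hS : S.LocalLoops) {κ M θ : ℝ} (hκ : 0 < κ)
    (hθ0 : 0 ≤ θ) (hθ1 : θ < 1) (hdata : ∀ i, κ ≤ lambdaMin (S.R i) ∧ lambdaMax (S.R i) ≤ M ∧
      κ ≤ S.μ i ∧ S.couplingSum D i ≤ θ * -(D.p i * S.ν i * S.δ i)) {w e : ℝ → NetState N}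
    (hsol : (S.closedLoop D).IsSolution w e) {r ω a : ℝ} (hr : ∀ i, ‖e 0 i‖ ≤ r)
    (hω : ∀ t, 0 ≤ t → ∀ i, ‖w t i‖ ≤ ω) (hM : 0 ≤ M) (ha : M / κ * r ^ 2 < a) {t : ℝ}
    (ht : 0 ≤ t) (i : Fin N) :
    ‖e t i‖ ^ 2 < a * Real.exp (-(κ * (1 - θ ^ 2) / 2) * t) +
      8 * M / ((1 - θ ^ 2) ^ 2 * κ ^ 3) * ω ^ 2 := by
  obtain ⟨α, hα⟩ : ∃ α, α = κ * (1 - θ ^ 2) / 2 := ⟨_, rfl⟩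
  obtain ⟨d, hd⟩ : ∃ d, d = 8 * M / ((1 - θ ^ 2) ^ 2 * κ ^ 3) * ω ^ 2 := ⟨_, rfl⟩
  have hσ0 : 0 < 1 - θ ^ 2 := by nlinarith
  have hd0 : 0 ≤ d := by rw [hd]; positivity
  have ha0 : 0 < a := lt_of_le_of_lt (by positivity) ha
  rw [← hα, ← hd]
  -- The rate `α = κ(1 - θ²)/2` is the slowest decay that the agents guarantee, and `d` is the level
  -- where decay balances the disturbance.
  let B : ℝ → ℝ := fun s => a * Real.exp (-α * s) + d
  have hB0 : ∀ s, 0 < B s := fun s => by positivity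
  have hBderiv : ∀ s, HasDerivAt B (a * (Real.exp (-α * s) * -α)) s := fun s => by
    have h1 : HasDerivAt (fun s : ℝ => -α * s) (-α) s := by
      simpa using (hasDerivAt_id s).const_mul (-α)
    exact (h1.exp.const_mul a).add_const d
  have hBc : Continuous B := by fun_prop
  let q : Fin N → NetState N → ℝ := fun i x =>
    inner ℝ (ErrorNetwork.agent i x) (BodyMat.op (S.R i) (ErrorNetwork.agent i x))
  have hq : ∀ i, ContDiff ℝ 1 (q i) := fun i => contDiff_quadraticForm_comp _ _
  have hqd : ∀ i x v, fderiv ℝ (q i) x v = 2 * inner ℝ (x i) (BodyMat.op (S.R i) (v i)) :=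
    fun i => fderiv_quadraticForm_comp (ErrorNetwork.agent i)
      (BodyMat.inner_op_comm (hS.R_posDef i).isHermitian)
  have hqlow : ∀ i x, lambdaMin (S.R i) * ‖x i‖ ^ 2 ≤ q i x := fun i x =>
    BodyMat.lambdaMin_mul_le_inner_op (hS.R_posDef i).isHermitian (x i)
  have hqc : ∀ i, ContinuousOn (fun s => q i (e s)) (Ici 0) := fun i =>
    (hq i).continuous.comp_continuousOn hsol.1
  have hlpos : ∀ i, 0 < lambdaMin (S.R i) := fun i => BodyMat.lambdaMin_pos (hS.R_posDef i)
  have hneg := neg_of_forall_first_zero (f := fun i s => q i (e s) - lambdaMin (S.R i) * B s)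
    (fun i => (hqc i).sub (continuous_const.mul hBc).continuousOn) ?_ ?_ i ht
  · have := (hqlow i (e t)).trans_lt (sub_neg.1 hneg)
    exact lt_of_mul_lt_mul_left this (hlpos i).le
  · intro j
    rw [sub_neg]
    calc q j (e 0) ≤ lambdaMax (S.R j) * ‖e 0 j‖ ^ 2 :=
          BodyMat.inner_op_le_lambdaMax (hS.R_posDef j).isHermitian _
      _ ≤ M * r ^ 2 := by
          have := (hdata j).2.1
          have := hr j
          gcongr
      _ = κ * (M / κ * r ^ 2) := by field_simp
      _ < κ * a := by gcongr
      _ ≤ lambdaMin (S.R j) * a := by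
          have := (hdata j).1
          gcongr
      _ ≤ lambdaMin (S.R j) * B 0 := by
          have := hlpos j
          simp only [B, mul_zero, Real.exp_zero, mul_one]
          gcongr
          linarith
  · intro k τ hτ hle hzero
    obtain ⟨hκmin, hmax, hκμ, hθ⟩ := hdata k
    have hgt : lambdaMin (S.R k) * ((1 - (1 - θ ^ 2) / 4) * B τ) < q k (e τ) := by
      rw [sub_eq_zero.1 hzero]
      have := hlpos k
      have := hB0 τ
      gcongr
      nlinarith
    -- Contact at `τ` puts agent `k` near the maximum on a whole interval to the left, where the
    -- decay estimate can be integrated.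
    have hev : ∀ᶠ s in 𝓝[≤] τ,
        lambdaMin (S.R k) * ((1 - (1 - θ ^ 2) / 4) * B s) < q k (e s) := by
      refine (Tendsto.eventually_lt ?_ ((hqc k).continuousAt (Ici_mem_nhds hτ)) hgt).filter_mono
        nhdsWithin_le_nhds
      exact (continuous_const.mul (continuous_const.mul hBc)).tendsto τ
    obtain ⟨l, hl, hlτ⟩ := mem_nhdsLE_iff_exists_Icc_subset.1 hev
    refine ⟨max l 0, ⟨le_max_right _ _, max_lt hl hτ⟩, ?_⟩
    obtain ⟨hint, hftc⟩ := hsol.integral_fderiv (hq k) (le_max_right l 0) (max_lt hl hτ).le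
    have hB'c : Continuous fun s => lambdaMin (S.R k) * (a * (Real.exp (-α * s) * -α)) := by
      fun_prop
    have hBint := intervalIntegral.integral_eq_sub_of_hasDerivAt (a := max l 0) (b := τ)
      (fun s _ => (hBderiv s).const_mul (lambdaMin (S.R k))) (hB'c.intervalIntegrable _ _)
    have hmono := intervalIntegral.integral_mono_on (max_lt hl hτ).le hint
      (hB'c.intervalIntegrable (max l 0) τ) fun s hs => ?_
    · rw [← hftc, hBint] at hmono
      linarith
    · have hs0 : 0 ≤ s := (le_max_right l 0).trans hs.1
      rw [hqd]
      refine (h.two_mul_inner_op_field_le_of_near_max hS hκ hθ0 hθ1 (hB0 s).le hκmin hmax hκμ hθ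
        (fun j => ?_) (hω s hs0 k) (hlτ ⟨(le_max_left l 0).trans hs.1, hs.2⟩).le).trans ?_
      -- Before contact all energies lie below their barriers, hence `‖e_j‖² ≤ B`: this is where the
      -- agents are coupled.
      · exact le_of_mul_le_mul_left
          ((hqlow j (e s)).trans (sub_nonpos.1 (hle j s ⟨hs0, hs.2⟩))) (hlpos j)
      · refine mul_le_mul_of_nonneg_left ?_ (hlpos k).le
        rw [← hd, show d - B s = -(a * Real.exp (-α * s)) by simp [B],
          show a * (Real.exp (-α * s) * -α) = -(κ * ((1 - θ ^ 2) / 2 * (a * Real.exp (-α * s)))) by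
            rw [hα]; ring, mul_neg, mul_neg]
        gcongr

/-- The exponential estimate for the largest agent error. -/
theorem Constraints.iSup_norm_le (h : S.Constraints D) (hS : S.LocalLoops) {κ M θ : ℝ} (hκ : 0 < κ)
    (hθ0 : 0 ≤ θ) (hθ1 : θ < 1) (hM : 0 ≤ M)
    (hdata : ∀ i, κ ≤ lambdaMin (S.R i) ∧ lambdaMax (S.R i) ≤ M ∧
      κ ≤ S.μ i ∧ S.couplingSum D i ≤ θ * -(D.p i * S.ν i * S.δ i)) {w e : ℝ → NetState N}
    (hsol : (S.closedLoop D).IsSolution w e) {r ω : ℝ} (hr0 : 0 ≤ r) (hr : ∀ i, ‖e 0 i‖ ≤ r)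
    (hω0 : 0 ≤ ω) (hω : ∀ t, 0 ≤ t → ∀ i, ‖w t i‖ ≤ ω) {t : ℝ} (ht : 0 ≤ t) :
    ⨆ i, ‖e t i‖ ≤ √(M / κ) * r * Real.exp (-(κ * (1 - θ ^ 2) / 4) * t) +
      √(8 * M / ((1 - θ ^ 2) ^ 2 * κ ^ 3)) * ω := by
  refine Real.iSup_le (fun i => ?_) (by positivity)
  set E := Real.exp (-(κ * (1 - θ ^ 2) / 4) * t) with hE
  have hEsq : Real.exp (-(κ * (1 - θ ^ 2) / 2) * t) = E ^ 2 := by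
    rw [hE, ← Real.exp_nat_mul]
    congr 1
    push_cast
    ring
  have hEpos : 0 < E := Real.exp_pos _
  have hc : 0 ≤ 8 * M / ((1 - θ ^ 2) ^ 2 * κ ^ 3) := by positivity
  have hsq : ‖e t i‖ ^ 2 ≤ M / κ * r ^ 2 * E ^ 2 +
      8 * M / ((1 - θ ^ 2) ^ 2 * κ ^ 3) * ω ^ 2 := by
    -- The barrier must start strictly above the initial energies; the excess `ε / E²` has decayed
    -- to `ε` at time `t`.
    refine le_of_forall_pos_lt_add fun ε hε => ?_
    have := h.norm_sq_lt hS hκ hθ0 hθ1 hdata hsol hr hω hM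
      (a := M / κ * r ^ 2 + ε / E ^ 2) (lt_add_of_pos_right _ (by positivity)) ht i
    rw [hEsq, add_mul, div_mul_cancel₀ _ (by positivity)] at this
    linarith
  refine le_of_sq_le_sq ?_ (by positivity)
  refine hsq.trans ?_
  rw [add_sq, mul_pow, mul_pow, mul_pow, Real.sq_sqrt (by positivity), Real.sq_sqrt hc]
  have : 0 ≤ 2 * (√(M / κ) * r * E) * (√(8 * M / ((1 - θ ^ 2) ^ 2 * κ ^ 3)) * ω) := by positivity
  linarith

end DesignData

/-! ### Comparison functions and uniform constants -/

theorem isClassKL_mul_exp {c α : ℝ} (hc : 0 < c) (hα : 0 < α) :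
    IsClassKL fun r t => c * r * Real.exp (-α * t) := by
  refine ⟨fun t _ => ⟨by fun_prop, fun x _ y _ hxy => ?_, by simp⟩, fun r hr => ⟨?_, ?_⟩⟩
  · dsimp only
    gcongr
  · intro s _ t _ hst
    have : -α * t ≤ -α * s := mul_le_mul_of_nonpos_left hst (neg_nonpos.2 hα.le)
    dsimp only
    gcongr
  · have h1 : Tendsto (fun t : ℝ => -α * t) atTop atBot :=
      tendsto_id.const_mul_atTop_of_neg (neg_neg_of_pos hα)
    simpa using (Real.tendsto_exp_atBot.comp h1).const_mul (c * r)

theorem isClassKInf_const_mul {c : ℝ} (hc : 0 < c) : IsClassKInf fun r => c * r := by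
  refine ⟨⟨by fun_prop, fun x _ y _ hxy => ?_, by simp⟩, tendsto_id.const_mul_atTop hc⟩
  dsimp only
  gcongr

theorem isScalableMeshStable_of_uniformData {Λ : Type*} {N : Λ → ℕ} {S : ∀ l, DesignData (N l)}
    {D : ∀ l, DesignVars (N l)} (hS : ∀ l, (S l).LocalLoops)
    (hD : ∀ l, (S l).Constraints (D l)) (hU : UniformData S D) :
    IsScalableMeshStable N fun l => (S l).closedLoop (D l) := by
  obtain ⟨κ, M', θ', hκ, hθ', hdata'⟩ := hU
  obtain ⟨θ, M, hθ0, hθ1, hM, hdata⟩ : ∃ θ M : ℝ, 0 ≤ θ ∧ θ < 1 ∧ 0 < M ∧ ∀ l i,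
      κ ≤ lambdaMin ((S l).R i) ∧ lambdaMax ((S l).R i) ≤ M ∧ κ ≤ (S l).μ i ∧
      (S l).couplingSum (D l) i ≤ θ * -((D l).p i * (S l).ν i * (S l).δ i) := by
    -- The given `θ'` may be negative and, in a family without agents, `M'` need not be positive;
    -- enlarging both preserves the bounds.
    refine ⟨max θ' 0, max M' 1, le_max_right _ _, max_lt hθ' one_pos,
      one_pos.trans_le (le_max_right _ _), fun l i => ?_⟩
    obtain ⟨h1, h2, h3, h4⟩ := hdata' l i
    refine ⟨h1, h2.trans (le_max_left _ _), h3, h4.trans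
      (mul_le_mul_of_nonneg_right (le_max_left _ _) ?_)⟩
    rw [← neg_mul]
    exact (mul_pos ((hD l).neg_p_mul_ν_pos i) ((hS l).δ_pos i)).le
  have hσ : 0 < 1 - θ ^ 2 := by nlinarith
  -- The estimate is global, so the radii `1, 1` are arbitrary.
  refine ⟨fun r t => √(M / κ) * r * Real.exp (-(κ * (1 - θ ^ 2) / 4) * t),
    fun r => √(8 * M / ((1 - θ ^ 2) ^ 2 * κ ^ 3)) * r, 1, 1,
    isClassKL_mul_exp (by positivity) (by positivity), isClassKInf_const_mul (by positivity),
    one_pos, one_pos, fun l e₀ w hwm hwb _ _ => ?_⟩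
  have hω : ∀ t, 0 ≤ t → ∀ i, ‖w t i‖ ≤ ⨆ i, ⨆ t : Ici (0 : ℝ), ‖w t i‖ := fun t ht i =>
    (le_ciSup (hwb i) ⟨t, ht⟩).trans
      (le_ciSup (f := fun i => ⨆ t : Ici (0 : ℝ), ‖w t i‖) (finite_range _).bddAbove i)
  refine ⟨?_, fun e he he0 t ht => ?_⟩
  · refine ErrorNetwork.exists_isSolution _ hwm
      -- This bound grows with `N` but serves existence only.
      (C := √(∑ _i : Fin (N l), (⨆ i, ⨆ t : Ici (0 : ℝ), ‖w t i‖) ^ 2)) (fun t ht => ?_) e₀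
    rw [PiLp.norm_eq_of_L2]
    refine Real.sqrt_le_sqrt (Finset.sum_le_sum fun i _ => ?_)
    have := hω t ht i
    gcongr
  · subst he0
    exact (hD l).iSup_norm_le (hS l) hκ hθ0 hθ1 hM.le (hdata l) he
      (Real.iSup_nonneg fun i => norm_nonneg _)
      (fun i => le_ciSup (f := fun i => ‖e 0 i‖) (finite_range _).bddAbove i)
      (Real.iSup_nonneg fun i => Real.iSup_nonneg fun t => norm_nonneg _) hω ht

theorem exists_gt_forall_le_of_finite {ι : Type*} [Finite ι] {f : ι → ℝ} {c : ℝ}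
    (h : ∀ i, c < f i) : ∃ b, c < b ∧ ∀ i, b ≤ f i := by
  cases isEmpty_or_nonempty ι
  · exact ⟨c + 1, lt_add_one c, fun i => isEmptyElim i⟩
  · obtain ⟨i, hi⟩ := Finite.exists_min f
    exact ⟨f i, h i, hi⟩

/-- The data of a single network are always bounded uniformly over its agents. -/
theorem uniformData_single {N : ℕ} {S : DesignData N} {D : DesignVars N} (hS : S.LocalLoops)
    (hD : S.Constraints D) :
    UniformData (Λ := Unit) (N := fun _ => N) (fun _ => S) fun _ => D := by
  have hP : ∀ i, 0 < -(D.p i * S.ν i * S.δ i) := fun i => by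
    rw [← neg_mul]
    exact mul_pos (hD.neg_p_mul_ν_pos i) (hS.δ_pos i)
  obtain ⟨κ₁, hκ₁, h₁⟩ := exists_gt_forall_le_of_finite fun i =>
    BodyMat.lambdaMin_pos (hS.R_posDef i)
  obtain ⟨κ₂, hκ₂, h₂⟩ := exists_gt_forall_le_of_finite hS.μ_pos
  obtain ⟨M, hM⟩ := (finite_range fun i => lambdaMax (S.R i)).bddAbove
  -- Ratios below `1` are negated to fit a lower-bound lemma; `-θ` is then the common margin.
  obtain ⟨θ, hθ, h₃⟩ := exists_gt_forall_le_of_finite (c := -1)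
    (f := fun i => -(S.couplingSum D i / -(D.p i * S.ν i * S.δ i)))
    fun i => neg_lt_neg ((div_lt_one (hP i)).2 (hD.weak_coupling i))
  refine ⟨min κ₁ κ₂, M, -θ, lt_min hκ₁ hκ₂, by linarith, fun _ i =>
    ⟨(min_le_left _ _).trans (h₁ i), hM (mem_range_self i), (min_le_right _ _).trans (h₂ i), ?_⟩⟩
  rw [← div_le_iff₀ (hP i)]
  exact le_neg_of_le_neg (h₃ i)

theorem theorem1 {Λ : Type*} (N : Λ → ℕ) (S : ∀ l, DesignData (N l)) (D : ∀ l, DesignVars (N l))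
    (hS : ∀ l, (S l).LocalLoops)
    (hD : ∀ l, D l ∈ (S l).centralizedProblem.feasible) :
    (∀ l, (D l).γ ^ 2 < (S l).γbar ∧
      ((S l).closedLoop (D l)).IsL2Stable (D l).γ ∧
      IsScalableMeshStable (fun _ : Unit => N l) (fun _ => (S l).closedLoop (D l))) ∧
    (UniformData S D →
      IsScalableMeshStable N (fun l => (S l).closedLoop (D l))) := by
  refine ⟨fun l => ⟨(hD l).γ_lt, ?_, ?_⟩, isScalableMeshStable_of_uniformData hS hD⟩
  · exact ErrorNetwork.isL2Stable_of_isDissipative (hD l).γ_pos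
      (DesignData.Constraints.isDissipative_closedLoop (hD l) (hS l))
  · exact isScalableMeshStable_of_uniformData (fun _ => hS l) (fun _ => hD l)
      (uniformData_single (hS l) (hD l))
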